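/- Modules are unital right modules, and $\operatorname{gldim} R$ denotes the right global dimension of a ring $R$, that is, the supremum of the projective dimensions of all right $R$-modules (with the zero module having projective dimension $-\infty$). Let $A$ be a (not necessarily commutative) ring with unit and let $M$ be a right $A$-module that is a generator, that is, there are an integer $n\ge 0$ and an $A$-linear epimorphism $M^n\to A$. Let $d\ge 0$ be an integer, and assume that the endomorphism ring $\operatorname{End}_A(M)$, with composition of maps as multiplication, is right noetherian of finite global dimension $\operatorname{gldim}\operatorname{End}_A(M)=d$. If $\operatorname{Ext}^i_A(M,M)=0$ for all integers $i$ with $1\le i\le d-1$, then $M$ is a finitely generated projective $A$-module and $\operatorname{gldim} A=d$. -/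

import Mathlib

open CategoryTheory

universe u

/-- A right module `M` over `A` (that is, a module over `Aᵐᵒᵖ`) is a *generator* if there is an
`A`-linear epimorphism from a finite direct sum of copies of `M` onto the right module `A`. -/
def IsRightGenerator (A M : Type u) [Ring A] [AddCommGroup M] [Module Aᵐᵒᵖ M] : Prop :=
  ∃ (n : ℕ) (f : (Fin n → M) →ₗ[Aᵐᵒᵖ] A), Function.Surjective f

/-- The right global dimension of a ring: the supremum of the projective dimensions of all its
right modules. (The zero module has projective dimension `⊥`.) -/
noncomputable def rightGlobalDimension (R : Type u) [Ring R] : WithBot ℕ∞ :=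
  ⨆ X : ModuleCat.{u} Rᵐᵒᵖ, projectiveDimension X

/-! Let `G` be the generator, `E` its endomorphism ring, `F = Hom(G, -)`. By Gabriel–Popescu `F` is
fully faithful with an exact left adjoint `L`, so `F` is an equivalence as soon as `L` kills no
nonzero module; finitely generated modules suffice. If `L N = 0`, take finitely generated
projectives `P₁ → P₀ → N → 0` with second syzygy `K₂`. The unit is an isomorphism on `P₁` and `P₀`,
and `Ext¹(G, L K₂) = 0` by dimension shifting, so `P₁ → P₀` is the image under `F` of an epimorphism
that `F` preserves. Hence `N = 0` (`Adjunction.isZero_of_isZero_obj_of_finite`). The equivalence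
preserves global dimension and makes `G` projective; finiteness comes from the ideal of
endomorphisms with range in a finitely generated submodule. -/

open Limits

universe v w

namespace ModuleCat

variable {S : Type v} [Ring S]

/-- The identity of a finitely generated projective module is a sum of maps factoring through the
ring. -/
theorem exists_id_eq_sum (P : ModuleCat.{v} S) [Module.Finite S P] [Projective P] :
    ∃ (n : ℕ) (a : Fin n → (P ⟶ of S S)) (b : Fin n → (of S S ⟶ P)),
      𝟙 P = ∑ i, a i ≫ b i := by
  have : Module.Projective S P := (IsProjective.iff_projective P).2 inferInstance
  obtain ⟨n, f, g, -, -, hfg⟩ := Module.Finite.exists_comp_eq_id_of_projective S P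
  refine ⟨n, fun i => ofHom (LinearMap.proj i ∘ₗ g),
    fun i => ofHom (f ∘ₗ LinearMap.single S (fun _ => S) i), ?_⟩
  ext x
  have h : f (g x) = x := LinearMap.congr_fun hfg x
  have h2 : ∑ i, Pi.single (M := fun _ => S) i (g x i) = g x := Finset.univ_sum_single _
  simp only [hom_id, LinearMap.id_coe, id_eq, hom_sum, hom_comp, hom_ofHom, LinearMap.coe_sum,
    Finset.sum_apply, LinearMap.comp_apply, LinearMap.proj_apply, LinearMap.single_apply]
  rw [← map_sum, h2, h]

theorem exists_finite_syzygy [IsNoetherianRing S] (K : ModuleCat.{v} S) [Module.Finite S K] :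
    ∃ (K' P : ModuleCat.{v} S) (i : K' ⟶ P) (p : P ⟶ K) (w : i ≫ p = 0),
      (ShortComplex.mk i p w).ShortExact ∧ Module.Finite S K' ∧ Module.Finite S P ∧
        Projective P := by
  obtain ⟨n, f, surjf⟩ := Module.Finite.exists_fin' S K
  exact ⟨_, _, _, _, _, LinearMap.shortExact_shortComplexKer surjf,
    inferInstanceAs (Module.Finite S (LinearMap.ker f)),
    inferInstanceAs (Module.Finite S (Fin n → S)),
    (IsProjective.iff_projective (of S (Fin n → S))).1 Module.Projective.of_free⟩

end ModuleCat

namespace CategoryTheory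

/-! ### Projective dimension under exact functors and equivalences. -/

section ProjectiveDimension

universe v₁ v₂ u₁ u₂

variable {C : Type u₁} [Category.{v₁} C] [Abelian C] {D : Type u₂} [Category.{v₂} D] [Abelian D]

theorem Functor.hasProjectiveDimensionLT_obj [EnoughProjectives C] (F : C ⥤ D)
    [PreservesFiniteLimits F] [PreservesFiniteColimits F] [F.PreservesProjectiveObjects]
    (n : ℕ) (X : C) [hX : HasProjectiveDimensionLT X n] :
    HasProjectiveDimensionLT (F.obj X) n := by
  have : F.Additive := F.additive_of_preserves_binary_products
  induction n generalizing X with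
  | zero =>
    rw [hasProjectiveDimensionLT_zero_iff_isZero] at hX ⊢
    exact F.map_isZero hX
  | succ n ih =>
    obtain _ | n := n
    · have : Projective X := projective_iff_hasProjectiveDimensionLT_one.2 hX
      have : Projective (F.obj X) := F.projective_obj X
      infer_instance
    · let T : ShortComplex C := ⟨kernel.ι (Projective.π X), Projective.π X, by simp⟩
      have hT : T.ShortExact :=
        { exact := ShortComplex.exact_of_f_is_kernel _ (kernelIsKernel _) }
      have h₁ : HasProjectiveDimensionLT T.X₁ (n + 1) :=
        (hT.hasProjectiveDimensionLT_X₃_iff n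
          (inferInstanceAs (Projective (Projective.over X)))).1 hX
      exact ((hT.map_of_exact F).hasProjectiveDimensionLT_X₃_iff n
        (F.projective_obj_of_projective
          (inferInstanceAs (Projective (Projective.over X))))).2 (ih T.X₁)

theorem Functor.projectiveDimension_obj_of_isEquivalence [EnoughProjectives C]
    [EnoughProjectives D] (F : C ⥤ D) [F.IsEquivalence] (X : C) :
    projectiveDimension (F.obj X) = projectiveDimension X := by
  have hF : F.PreservesProjectiveObjects :=
    ⟨fun h => F.asEquivalence.map_projective_iff _ |>.2 h⟩
  have hG : F.inv.PreservesProjectiveObjects :=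
    ⟨fun h => F.asEquivalence.symm.map_projective_iff _ |>.2 h⟩
  have key (n : ℕ) : projectiveDimension (F.obj X) < n ↔ projectiveDimension X < n := by
    rw [projectiveDimension_lt_iff, projectiveDimension_lt_iff]
    refine ⟨fun h => ?_, fun h => F.hasProjectiveDimensionLT_obj n X⟩
    have h' := F.inv.hasProjectiveDimensionLT_obj n (F.obj X)
    exact @hasProjectiveDimensionLT_of_iso _ _ _ _ _ (F.asEquivalence.unitIso.app X).symm n h'
  have key' (n : ℕ) : HasProjectiveDimensionLT (F.obj X) n ↔ HasProjectiveDimensionLT X n := by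
    simpa only [projectiveDimension_lt_iff] using key n
  simp only [projectiveDimension, key']

end ProjectiveDimension

/-! ### Modules killed by an exact reflector. -/

section Reflective

open Abelian

universe u₁ v₁

variable {S : Type v} [Ring S] {C : Type u₁} [Category.{v₁} C] [Abelian C]
  {L : ModuleCat.{v} S ⥤ C} {F : C ⥤ ModuleCat.{v} S} {G : C}

/-- The unit is invertible at `S ≅ F G`; its inverse at `P` is assembled from that one along the
maps that split `P` off a power of `S`. -/
theorem Adjunction.isIso_unit_app_of_finite_of_projective (adj : L ⊣ F) [F.Full] [F.Faithful]
    [L.Additive] [F.Additive] (e : ModuleCat.of S S ≅ F.obj G) (P : ModuleCat.{v} S)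
    [Module.Finite S P] [Projective P] : IsIso (adj.unit.app P) := by
  obtain ⟨n, a, b, h⟩ := P.exists_id_eq_sum
  have : IsIso (adj.unit.app (ModuleCat.of S S)) := adj.isIso_unit_app_of_iso e
  have nat {X Y : ModuleCat.{v} S} (f : X ⟶ Y) :
      adj.unit.app X ≫ F.map (L.map f) = f ≫ adj.unit.app Y := (adj.unit.naturality f).symm
  refine ⟨∑ i, F.map (L.map (a i)) ≫ inv (adj.unit.app (ModuleCat.of S S)) ≫ b i, ?_, ?_⟩
  · refine Eq.trans ?_ h.symm
    rw [Preadditive.comp_sum]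
    refine Finset.sum_congr rfl fun i _ => ?_
    rw [reassoc_of% (nat (a i)), IsIso.hom_inv_id_assoc]
  · have h' : 𝟙 (F.obj (L.obj P)) = ∑ i, F.map (L.map (a i)) ≫ F.map (L.map (b i)) := by
      rw [← F.map_id, ← L.map_id, h, Functor.map_sum, Functor.map_sum]
      simp
    refine Eq.trans ?_ h'.symm
    rw [Preadditive.sum_comp]
    refine Finset.sum_congr rfl fun i _ => ?_
    rw [Category.assoc, Category.assoc, ← nat (b i), IsIso.inv_hom_id_assoc]

variable [HasExt.{w} C]

theorem Adjunction.ext_obj_eq_zero_of_finite_of_projective (adj : L ⊣ F) [F.Full] [F.Faithful]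
    [L.Additive] (e : ModuleCat.of S S ≅ F.obj G) (j : ℕ) [Subsingleton (Ext.{w} G G j)]
    (P : ModuleCat.{v} S) [Module.Finite S P] [Projective P] (x : Ext.{w} G (L.obj P) j) :
    x = 0 := by
  obtain ⟨n, a, b, h⟩ := P.exists_id_eq_sum
  let e' : L.obj (ModuleCat.of S S) ≅ G := L.mapIso e ≪≫ asIso (adj.counit.app G)
  have h' : 𝟙 (L.obj P) = ∑ i, (L.map (a i) ≫ e'.hom) ≫ e'.inv ≫ L.map (b i) := by
    rw [← L.map_id, h, Functor.map_sum]
    simp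
  rw [← Ext.comp_mk₀_id x, h', Ext.mk₀_sum, Ext.comp_sum]
  refine Finset.sum_eq_zero fun i _ => ?_
  rw [← Ext.mk₀_comp_mk₀, ← Ext.comp_assoc_of_third_deg_zero,
    Subsingleton.elim (x.comp (Ext.mk₀ (L.map (a i) ≫ e'.hom)) (add_zero j)) 0, Ext.zero_comp]

/-- Dimension shifting: since `L` is exact, a syzygy of `K` trades one unit of `k` for one of `j`,
keeping `j + k` fixed. Noetherianity keeps syzygies finitely generated. -/
theorem Adjunction.ext_obj_eq_zero_of_hasProjectiveDimensionLT [IsNoetherianRing S]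
    (adj : L ⊣ F) [F.Full] [F.Faithful]
    [PreservesFiniteLimits L] (e : ModuleCat.of S S ≅ F.obj G) (d : ℕ)
    (hext : ∀ i : ℕ, 1 ≤ i → i + 1 ≤ d → Subsingleton (Ext.{w} G G i)) (k : ℕ)
    (K : ModuleCat.{v} S) [Module.Finite S K] [hK : HasProjectiveDimensionLT K (k + 1)]
    (j : ℕ) (hj : 1 ≤ j) (hjk : j + k + 1 ≤ d) (x : Ext.{w} G (L.obj K) j) : x = 0 := by
  have : L.IsLeftAdjoint := adj.isLeftAdjoint
  have : L.Additive := L.additive_of_preserves_binary_products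
  induction k generalizing K j with
  | zero =>
    have := hext j hj hjk
    have : Projective K := projective_iff_hasProjectiveDimensionLT_one.2 hK
    exact adj.ext_obj_eq_zero_of_finite_of_projective e j K x
  | succ k ih =>
    obtain ⟨K', P, i, p, w, hT, _, _, hP⟩ := K.exists_finite_syzygy
    have := (hT.hasProjectiveDimensionLT_X₃_iff k hP).1 hK
    have hx := ih K' (j + 1) (by lia) (by lia) (x.comp (hT.map_of_exact L).extClass rfl)
    obtain ⟨y, rfl⟩ := Ext.covariant_sequence_exact₃ G (hT.map_of_exact L) x rfl hx
    have := hext j hj (by lia)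
    have hy : y = 0 := adj.ext_obj_eq_zero_of_finite_of_projective e j P y
    rw [hy, Ext.zero_comp]
    rfl

/-- `hF` records the only feature of `F = Hom(G, -)` needed beyond the adjunction. -/
theorem Adjunction.isZero_of_isZero_obj_of_finite [IsNoetherianRing S]
    (adj : L ⊣ F) [F.Full] [F.Faithful]
    [PreservesFiniteLimits L] (e : ModuleCat.of S S ≅ F.obj G)
    (hF : ∀ {X Y : C} (f : X ⟶ Y), (∀ g : G ⟶ Y, ∃ h : G ⟶ X, h ≫ f = g) → Epi (F.map f))
    (d : ℕ)
    (hext : ∀ i : ℕ, 1 ≤ i → i + 1 ≤ d → Subsingleton (Ext.{w} G G i))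
    (N : ModuleCat.{v} S) [Module.Finite S N] [hN : HasProjectiveDimensionLT N (d + 1)]
    (hLN : IsZero (L.obj N)) : IsZero N := by
  have : L.IsLeftAdjoint := adj.isLeftAdjoint
  have : F.IsRightAdjoint := adj.isRightAdjoint
  have : L.Additive := L.additive_of_preserves_binary_products
  have : F.Additive := F.additive_of_preserves_binary_products
  obtain ⟨K₁, P₀, i₀, p₀, w₀, hT₀, _, _, hP₀⟩ := N.exists_finite_syzygy
  obtain ⟨K₂, P₁, i₁, p₁, w₁, hT₁, _, _, hP₁⟩ := K₁.exists_finite_syzygy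
  have hLi : IsIso (L.map i₀) := by
    have : Mono (L.map i₀) := (hT₀.map_of_exact L).mono_f
    have : Epi (L.map i₀) := ((hT₀.map_of_exact L).exact.epi_f_iff).2 (hLN.eq_of_tgt _ _)
    exact isIso_of_mono_of_epi (L.map i₀)
  have hp : Epi (F.map (L.map p₁)) := by
    -- For `d ≤ 1` the first syzygy is already projective and `p₁` splits; otherwise `K₂` has
    -- dimension at most `d - 2`, just enough for `Ext¹(G, L K₂) = 0`.
    obtain hd | ⟨k, rfl⟩ : d ≤ 1 ∨ ∃ k, d = k + 2 := by
      obtain hd | hd := Nat.lt_or_ge 1 d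
      · exact .inr ⟨d - 2, by lia⟩
      · exact .inl hd
    · have : HasProjectiveDimensionLT N 2 := hasProjectiveDimensionLT_of_ge N (d + 1) 2 (by lia)
      have : Projective K₁ := projective_iff_hasProjectiveDimensionLT_one.2
        ((hT₀.hasProjectiveDimensionLT_X₃_iff 0 hP₀).1 this)
      have : Epi p₁ := hT₁.epi_g
      refine @IsSplitEpi.epi _ _ _ _ _
        (IsSplitEpi.mk' ⟨F.map (L.map (Projective.factorThru (𝟙 K₁) p₁)), ?_⟩)
      rw [← F.map_comp, ← L.map_comp, Projective.factorThru_comp, L.map_id, F.map_id]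
    · have := (hT₀.hasProjectiveDimensionLT_X₃_iff (k + 1) hP₀).1 hN
      have := (hT₁.hasProjectiveDimensionLT_X₃_iff k hP₁).1 this
      refine hF _ fun g => ?_
      obtain ⟨y, hy⟩ := Ext.covariant_sequence_exact₃ G (hT₁.map_of_exact L) (Ext.mk₀ g) rfl
        (adj.ext_obj_eq_zero_of_hasProjectiveDimensionLT e (k + 2) hext k K₂ 1 le_rfl (by lia) _)
      obtain ⟨h, rfl⟩ := (Ext.mk₀_bijective _ _).2 y
      rw [Ext.mk₀_comp_mk₀] at hy
      exact ⟨h, (Ext.mk₀_bijective _ _).1 hy⟩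
  let η₁ : P₁ ⟶ F.obj (L.obj P₁) := adj.unit.app P₁
  let η₀ : P₀ ⟶ F.obj (L.obj P₀) := adj.unit.app P₀
  have : IsIso η₁ := adj.isIso_unit_app_of_finite_of_projective e P₁
  have : IsIso η₀ := adj.isIso_unit_app_of_finite_of_projective e P₀
  have h : p₁ ≫ i₀ = (η₁ ≫ F.map (L.map p₁)) ≫ F.map (L.map i₀) ≫ inv η₀ := by
    have : (p₁ ≫ i₀) ≫ η₀ = η₁ ≫ F.map (L.map (p₁ ≫ i₀)) := adj.unit.naturality (p₁ ≫ i₀)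
    rw [L.map_comp, F.map_comp] at this
    rw [← Category.assoc, IsIso.eq_comp_inv, this, Category.assoc]
  have hpi : Epi (p₁ ≫ i₀) := by
    rw [h]
    have : Epi η₁ := IsIso.epi_of_iso η₁
    have : IsIso (F.map (L.map i₀) ≫ inv η₀) := inferInstance
    have : Epi (F.map (L.map i₀) ≫ inv η₀) := IsIso.epi_of_iso _
    exact epi_comp' (epi_comp' ‹_› hp) ‹_›
  have hi : Epi i₀ := epi_of_epi p₁ i₀
  have : Epi p₀ := hT₀.epi_g
  rw [IsZero.iff_id_eq_zero, ← cancel_epi p₀, ← cancel_epi i₀]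
  simp [w₀]

end Reflective

end CategoryTheory

namespace CategoryTheory

open Abelian IsGrothendieckAbelian

/-! ### From vanishing on finitely generated modules to an equivalence. -/

section

universe u₁ v₁

variable {S : Type v} [Ring S] {C : Type u₁} [Category.{v₁} C] [Abelian C]
  {L : ModuleCat.{v} S ⥤ C} {F : C ⥤ ModuleCat.{v} S}

theorem Functor.isZero_of_isZero_obj [PreservesFiniteLimits L]
    (hL : ∀ N : ModuleCat.{v} S, Module.Finite S N → IsZero (L.obj N) → IsZero N)
    (N : ModuleCat.{v} S) (hN : IsZero (L.obj N)) : IsZero N := by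
  have h0 (x : N) : x = 0 := by
    let j : ModuleCat.of S (S ∙ x) ⟶ N := ModuleCat.ofHom (Submodule.subtype _)
    have : Mono j := (ModuleCat.mono_iff_injective j).2 (Submodule.injective_subtype _)
    have hfin : Module.Finite S (ModuleCat.of S (S ∙ x)) :=
      inferInstanceAs (Module.Finite S (S ∙ x))
    have hz := hL _ hfin (IsZero.of_mono (L.map j) hN)
    have := ModuleCat.subsingleton_of_isZero hz
    have h : (⟨x, Submodule.mem_span_singleton_self x⟩ : (S ∙ x)) = 0 :=
      Subsingleton.elim (α := ModuleCat.of S (S ∙ x)) _ _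
    exact congrArg Subtype.val h
  have : Subsingleton N := ⟨fun x y => by rw [h0 x, h0 y]⟩
  exact ModuleCat.isZero_of_subsingleton N

/-- `L` inverts the unit and is exact, so it kills the unit's kernel and cokernel. -/
theorem Adjunction.isEquivalence_of_isZero (adj : L ⊣ F) [F.Full] [F.Faithful]
    [PreservesFiniteLimits L]
    (hL : ∀ N : ModuleCat.{v} S, Module.Finite S N → IsZero (L.obj N) → IsZero N) :
    F.IsEquivalence := by
  have : L.IsLeftAdjoint := adj.isLeftAdjoint
  have : L.Additive := L.additive_of_preserves_binary_products
  have key (N : ModuleCat.{v} S) : IsIso (adj.unit.app N) := by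
    let η : N ⟶ F.obj (L.obj N) := adj.unit.app N
    have hη : L.map η ≫ adj.counit.app (L.obj N) = 𝟙 _ := adj.left_triangle_components N
    have hiso : IsIso (L.map η) := by
      have : L.map η = inv (adj.counit.app (L.obj N)) := IsIso.eq_inv_of_inv_hom_id hη
      rw [this]
      infer_instance
    have hk : kernel.ι η = 0 := by
      refine (Functor.isZero_of_isZero_obj hL _ ?_).eq_of_src _ _
      have : Mono (kernel.ι η) := equalizer.ι_mono
      have : Mono (L.map (kernel.ι η)) := L.map_mono _
      have : Mono (L.map η) := IsIso.mono_of_iso _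
      rw [IsZero.iff_id_eq_zero, ← cancel_mono (L.map (kernel.ι η)), ← cancel_mono (L.map η)]
      simp [← L.map_comp]
    have hc : cokernel.π η = 0 := by
      refine (Functor.isZero_of_isZero_obj hL _ ?_).eq_of_tgt _ _
      have : Epi (cokernel.π η) := coequalizer.π_epi
      have : Epi (L.map (cokernel.π η)) := L.map_epi _
      have : Epi (L.map η) := IsIso.epi_of_iso _
      rw [IsZero.iff_id_eq_zero, ← cancel_epi (L.map (cokernel.π η)), ← cancel_epi (L.map η),
        ← Category.assoc, ← L.map_comp, cokernel.condition]
      simp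
    have : Mono η := Preadditive.mono_of_kernel_zero hk
    have : Epi η := Preadditive.epi_of_cokernel_zero hc
    exact isIso_of_mono_of_epi η
  have : F.EssSurj := ⟨fun N => ⟨L.obj N, ⟨(@asIso _ _ _ _ _ (key N)).symm⟩⟩⟩
  exact { }

end

/-- If the endomorphism ring of a separator `G` is right noetherian of right global dimension at
most `d`, and `G` has no self-extensions in degrees `1, …, d - 1`, then `Hom(G, -)` is an
equivalence. -/
theorem isEquivalence_preadditiveCoyonedaObj {C : Type w} [Category.{v} C] [Abelian C]
    [IsGrothendieckAbelian.{v} C] [HasExt.{v} C] (G : C) (hG : IsSeparator G)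
    [IsNoetherianRing (End G)ᵐᵒᵖ] (d : ℕ)
    (hd : ∀ X : ModuleCat.{v} (End G)ᵐᵒᵖ, HasProjectiveDimensionLT X (d + 1))
    (hext : ∀ i : ℕ, 1 ≤ i → i + 1 ≤ d → Subsingleton (Ext.{v} G G i)) :
    (preadditiveCoyonedaObj G).IsEquivalence := by
  have := GabrielPopescu.full G hG
  have := (isSeparator_iff_faithful_preadditiveCoyonedaObj G).1 hG
  have := GabrielPopescu.preservesFiniteLimits G hG
  refine (tensorObjPreadditiveCoyonedaObjAdjunction G).isEquivalence_of_isZero fun N _ hN => ?_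
  have := hd N
  refine (tensorObjPreadditiveCoyonedaObjAdjunction G).isZero_of_isZero_obj_of_finite
    (G := G) (Preadditive.homSelfLinearEquivEndMulOpposite G).symm.toModuleIso ?_ d hext N hN
  exact fun f hf => (ModuleCat.epi_iff_surjective _).2 hf

end CategoryTheory

/-! ### Finiteness and projectivity of the generator. -/

section Generator

variable {R M : Type u} [Ring R] [AddCommGroup M] [Module R M]

theorem Module.exists_sum_smul_eq {n : ℕ} (f : (Fin n → M) →ₗ[R] R)
    (hf : Function.Surjective f) :
    ∃ (φ : Fin n → (M →ₗ[R] R)) (v : Fin n → M), ∀ {N : Type u} [AddCommGroup N] [Module R N]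
      (x : N), x = ∑ i, φ i (v i) • x := by
  obtain ⟨v, hv⟩ := hf 1
  refine ⟨fun i => f ∘ₗ LinearMap.single R (fun _ => M) i, v, fun x => ?_⟩
  have h : ∑ i, Pi.single (M := fun _ => M) i (v i) = v := Finset.univ_sum_single v
  simp only [LinearMap.comp_apply, LinearMap.single_apply]
  rw [← Finset.sum_smul, ← map_sum, h, hv, one_smul]

theorem ModuleCat.isSeparator_of_surjective {n : ℕ} (f : (Fin n → M) →ₗ[R] R)
    (hf : Function.Surjective f) : IsSeparator (ModuleCat.of R M) := by
  obtain ⟨φ, v, h⟩ := Module.exists_sum_smul_eq f hf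
  rw [Preadditive.isSeparator_iff]
  intro X Y g hg
  ext x
  rw [h x, map_sum]
  refine Finset.sum_eq_zero fun i _ => ?_
  exact LinearMap.congr_fun (congrArg Hom.hom
    (hg (ofHom (LinearMap.toSpanSingleton R X x ∘ₗ φ i)))) (v i)

/-- The right ideal of endomorphisms whose range lies in a finitely generated submodule. -/
def finiteRangeIdeal (G : ModuleCat.{u} R) : Submodule (End G)ᵐᵒᵖ (End G)ᵐᵒᵖ where
  carrier := {f | ∃ N : Submodule R G, N.FG ∧ LinearMap.range f.unop.hom ≤ N}
  zero_mem' := ⟨⊥, Submodule.fg_bot, by rintro _ ⟨x, rfl⟩; simp⟩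
  add_mem' := by
    rintro f g ⟨N, hN, hf⟩ ⟨P, hP, hg⟩
    refine ⟨N ⊔ P, hN.sup hP, ?_⟩
    rintro _ ⟨x, rfl⟩
    exact Submodule.add_mem_sup (hf ⟨x, rfl⟩) (hg ⟨x, rfl⟩)
  smul_mem' := by
    rintro c f ⟨N, hN, hf⟩
    refine ⟨N, hN, ?_⟩
    rintro _ ⟨x, rfl⟩
    exact hf ⟨c.unop.hom x, rfl⟩

theorem ModuleCat.finite_of_isEquivalence_preadditiveCoyonedaObj {n : ℕ}
    (f : (Fin n → M) →ₗ[R] R) (hf : Function.Surjective f)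
    [(preadditiveCoyonedaObj (ModuleCat.of R M)).IsEquivalence] : Module.Finite R M := by
  obtain ⟨φ, v, h⟩ := Module.exists_sum_smul_eq f hf
  let G := ModuleCat.of R M
  let F := preadditiveCoyonedaObj G
  let J := finiteRangeIdeal G
  let Q := ModuleCat.of (End G)ᵐᵒᵖ ((End G)ᵐᵒᵖ ⧸ J)
  let X := F.objPreimage Q
  let e : Q ≅ F.obj X := (F.objObjPreimageIso Q).symm
  -- The class of `1` in `E/J` becomes a morphism `x` out of `G` annihilated by `J`. The maps `y ↦ φ
  -- i y • m` lie in `J` and generate every `m`, so `x = 0` and `1 ∈ J`.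
  let x : G ⟶ X := e.hom.hom (J.mkQ 1)
  have hx (g : (End G)ᵐᵒᵖ) (hg : g ∈ J) : g.unop ≫ x = 0 := by
    have h1 : e.hom.hom (g • J.mkQ 1) = g • e.hom.hom (J.mkQ 1) := map_smul _ _ _
    have h2 : g • J.mkQ 1 = 0 := by
      rw [← map_smul, smul_eq_mul, mul_one]
      exact (Submodule.Quotient.mk_eq_zero J).2 hg
    rw [h2, map_zero] at h1
    exact h1.symm
  have hx0 : x = 0 := by
    ext m
    change x.hom m = 0
    rw [h m, map_sum]
    refine Finset.sum_eq_zero fun i _ => ?_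
    let g : G ⟶ G := ModuleCat.ofHom (LinearMap.toSpanSingleton R M m ∘ₗ φ i)
    refine LinearMap.congr_fun (congrArg ModuleCat.Hom.hom (hx (MulOpposite.op g) ?_)) (v i)
    refine ⟨R ∙ m, Submodule.fg_span_singleton m, ?_⟩
    rintro _ ⟨y, rfl⟩
    exact Submodule.smul_mem _ _ (Submodule.mem_span_singleton_self m)
  have h1 : J.mkQ 1 = 0 := by
    have : e.inv.hom (e.hom.hom (J.mkQ 1)) = J.mkQ 1 := e.hom_inv_id_apply (J.mkQ 1)
    rw [← this]
    exact (congrArg e.inv.hom hx0).trans (map_zero _)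
  obtain ⟨N, hN, hle⟩ := (Submodule.Quotient.mk_eq_zero J).1 h1
  have : N = ⊤ := top_le_iff.1 fun m _ => hle ⟨m, rfl⟩
  exact ⟨this ▸ hN⟩

theorem ModuleCat.projective_of_isEquivalence_preadditiveCoyonedaObj
    [(preadditiveCoyonedaObj (ModuleCat.of R M)).IsEquivalence] : Module.Projective R M := by
  refine (IsProjective.iff_projective M).2 ?_
  rw [Projective.projective_iff_preservesEpimorphisms_preadditiveCoyonedaObj]
  have : (preadditiveCoyonedaObj (of R M)).IsLeftAdjoint := Functor.isLeftAdjoint_of_isEquivalence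
  exact Functor.preservesEpimorphisms_of_isLeftAdjoint _

end Generator

theorem iSup_projectiveDimension_eq_of_isEquivalence {C D : Type w} [Category.{v} C] [Abelian C]
    [EnoughProjectives C] [Category.{v} D] [Abelian D] [EnoughProjectives D] (F : C ⥤ D)
    [F.IsEquivalence] :
    ⨆ X : D, projectiveDimension X = ⨆ X : C, projectiveDimension X := by
  refine le_antisymm (iSup_le fun X => ?_) (iSup_le fun X => ?_)
  · rw [← projectiveDimension_eq_of_iso (F.objObjPreimageIso X),
      F.projectiveDimension_obj_of_isEquivalence]
    exact le_iSup (fun X : C => projectiveDimension X) _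
  · rw [← F.projectiveDimension_obj_of_isEquivalence]
    exact le_iSup (fun X : D => projectiveDimension X) _

theorem corollary2 (A M : Type u) [Ring A] [AddCommGroup M] [Module Aᵐᵒᵖ M]
    (hgen : IsRightGenerator A M)
    (hnoeth : IsNoetherian (Module.End Aᵐᵒᵖ M)ᵐᵒᵖ (Module.End Aᵐᵒᵖ M))
    (d : ℕ) (hd : rightGlobalDimension (Module.End Aᵐᵒᵖ M) = d)
    (hext : ∀ i : ℕ, 1 ≤ i → i + 1 ≤ d →
      Subsingleton (Abelian.Ext (ModuleCat.of Aᵐᵒᵖ M) (ModuleCat.of Aᵐᵒᵖ M) i)) :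
    (Module.Finite Aᵐᵒᵖ M ∧ Module.Projective Aᵐᵒᵖ M) ∧ rightGlobalDimension A = d := by
  obtain ⟨n, f₀, hf₀⟩ := hgen
  let o : A ≃ₗ[Aᵐᵒᵖ] Aᵐᵒᵖ :=
    { MulOpposite.opAddEquiv with map_smul' := fun _ _ => rfl }
  let f : (Fin n → M) →ₗ[Aᵐᵒᵖ] Aᵐᵒᵖ := o.toLinearMap ∘ₗ f₀
  have hf : Function.Surjective f := o.surjective.comp hf₀
  let G := ModuleCat.of Aᵐᵒᵖ M
  let ε : (End G)ᵐᵒᵖ ≃+* (Module.End Aᵐᵒᵖ M)ᵐᵒᵖ := RingEquiv.op (ModuleCat.endRingEquiv G)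
  let o' : Module.End Aᵐᵒᵖ M ≃ₗ[(Module.End Aᵐᵒᵖ M)ᵐᵒᵖ] (Module.End Aᵐᵒᵖ M)ᵐᵒᵖ :=
    { MulOpposite.opAddEquiv with map_smul' := fun _ _ => rfl }
  have hnoeth' : IsNoetherianRing (Module.End Aᵐᵒᵖ M)ᵐᵒᵖ := isNoetherian_of_linearEquiv o'
  have : IsNoetherianRing (End G)ᵐᵒᵖ := isNoetherianRing_of_ringEquiv _ ε.symm
  have hdim : ⨆ X : ModuleCat.{u} (End G)ᵐᵒᵖ, projectiveDimension X = d := by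
    rw [← hd]
    exact iSup_projectiveDimension_eq_of_isEquivalence
      (ModuleCat.restrictScalarsEquivalenceOfRingEquiv ε).functor
  have hF : (preadditiveCoyonedaObj G).IsEquivalence :=
    isEquivalence_preadditiveCoyonedaObj G (ModuleCat.isSeparator_of_surjective f hf) d
      (fun X => (projectiveDimension_le_iff X d).1
        (hdim ▸ le_iSup (fun X : ModuleCat.{u} (End G)ᵐᵒᵖ => projectiveDimension X) X)) hext
  refine ⟨⟨ModuleCat.finite_of_isEquivalence_preadditiveCoyonedaObj f hf,
    ModuleCat.projective_of_isEquivalence_preadditiveCoyonedaObj⟩, ?_⟩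
  rw [← hdim]
  exact (iSup_projectiveDimension_eq_of_isEquivalence (preadditiveCoyonedaObj G)).symm
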